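/- **Theorem (Probability density function of the wrapped normal distribution on the hyperboloid).** Let $n$ be a nonnegative integer, $K<0$ and $R=1/\sqrt{-K}$. On $\mathbb R^{n+1}$ let $\langle x,y\rangle_{\mathcal L}=-x_1y_1+\sum_{i=2}^{n+1}x_iy_i$ and $\|v\|_{\mathcal L}=\sqrt{\langle v,v\rangle_{\mathcal L}}$ for $\langle v,v\rangle_{\mathcal L}\ge 0$. Let $\mathbb H_K^n=\{x\in\mathbb R^{n+1}:\langle x,x\rangle_{\mathcal L}=1/K,\ x_1>0\}$, with tangent spaces $T_x\mathbb H_K^n=\{v:\langle x,v\rangle_{\mathcal L}=0\}$, the Riemannian metric given by the restriction of $\langle\cdot,\cdot\rangle_{\mathcal L}$ to them, the associated Riemannian volume measure $\mathrm{vol}$, and the origin $\mu_0=(R,0,\dots,0)$. For $x,y\in\mathbb H_K^n$ and $v\in T_x\mathbb H_K^n$ let $$\exp_x^K(v)=\cosh\!\left(\tfrac{\|v\|_{\mathcal L}}{R}\right)x+\sinh\!\left(\tfrac{\|v\|_{\mathcal L}}{R}\right)\frac{Rv}{\|v\|_{\mathcal L}},\qquad \log_x^K(y)=\frac{\operatorname{arcosh}\alpha}{\sqrt{\alpha^2-1}}\,(y-\alpha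 x),\quad \alpha=K\langle x,y\rangle_{\mathcal L},$$ $$\mathrm{PT}^K_{x\to y}(v)=v+\frac{\langle y,v\rangle_{\mathcal L}}{R^2-\langle x,y\rangle_{\mathcal L}}\,(x+y),$$ with $\exp_x^K(0)=x$ and $\log_x^K(x)=0$. Let $\mu\in\mathbb H_K^n$ and let $\Sigma$ be a symmetric positive definite real $n\times n$ matrix. Identify $T_{\mu_0}\mathbb H_K^n=\{(0,w):w\in\mathbb R^n\}$ with $\mathbb R^n$, and let $\mathcal N(\,\cdot\,;0,\Sigma)$ be the Lebesgue density of the centred normal distribution with covariance $\Sigma$. The wrapped normal distribution with parameters $\mu,\Sigma$ is the law of $\exp_\mu^K\big(\mathrm{PT}^K_{\mu_0\to\mu}(v)\big)$, where $v\sim\mathcal N(0,\Sigma)$ in $T_{\mu_0}\mathbb H_K^n$. Then this law has exactly one continuous nonnegative density $z\mapsto\mathcal{WN}(z;\mu,\Sigma)$ with respect to $\mathrm{vol}$; it is strictly positive, and for every $z\in\mathbb H_K^n$ $$\log \mathcal{WN}(z;\mu,\Sigma)=\log\mathcal N(v;0,\Sigma)-(n-1)\log\!\left(\frac{R\sinh(\|u\|_{\mathcal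 L}/R)}{\|u\|_{\mathcal L}}\right),$$ where $u=\log_\mu^K(z)$ and $v=\mathrm{PT}^K_{\mu\to\mu_0}(u)$, and the last quotient is read as its limit $1$ when $u=0$ (that is, $z=\mu$). -/

import Mathlib

namespace HypWN

noncomputable section

/-- The Lorentz inner product on `ℝⁿ⁺¹`; the time-like coordinate is the first one. -/
def lorentzInner {n : ℕ} (x y : Fin (n + 1) → ℝ) : ℝ :=
  -(x 0 * y 0) + ∑ i : Fin n, x i.succ * y i.succ

/-- The Lorentz norm (used only for space-like vectors). -/
def lorentzNorm {n : ℕ} (v : Fin (n + 1) → ℝ) : ℝ := √(lorentzInner v v)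

/-- The radius `R = 1 / √(-K)` belonging to a curvature `K < 0`. -/
def radius (K : ℝ) : ℝ := 1 / √(-K)

/-- The hyperboloid of curvature `K < 0`: the upper sheet of `⟨x, x⟩ = 1 / K`. -/
def hyperboloid (n : ℕ) (K : ℝ) : Set (Fin (n + 1) → ℝ) :=
  {x | lorentzInner x x = 1 / K ∧ 0 < x 0}

theorem lorentzInner_comm {n : ℕ} (x y : Fin (n + 1) → ℝ) :
    lorentzInner x y = lorentzInner y x := by
  simp [lorentzInner, mul_comm]

theorem lorentzInner_add_right {n : ℕ} (x y z : Fin (n + 1) → ℝ) :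
    lorentzInner x (y + z) = lorentzInner x y + lorentzInner x z := by
  simp only [lorentzInner, Pi.add_apply, mul_add, Finset.sum_add_distrib]; ring

theorem lorentzInner_smul_right {n : ℕ} (c : ℝ) (x y : Fin (n + 1) → ℝ) :
    lorentzInner x (c • y) = c * lorentzInner x y := by
  simp only [lorentzInner, Pi.smul_apply, smul_eq_mul, mul_add, Finset.mul_sum]
  congr 1
  · ring
  · exact Finset.sum_congr rfl fun i _ => by ring

/-- The tangent space of the hyperboloid at `x`: the Lorentz-orthogonal complement of `x`. -/
def tangentSpace {n : ℕ} {K : ℝ} (x : hyperboloid n K) : Submodule ℝ (Fin (n + 1) → ℝ) where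
  carrier := {v | lorentzInner x.1 v = 0}
  zero_mem' := by simp [lorentzInner]
  add_mem' := by
    intro a b ha hb
    simp only [Set.mem_ofPred_eq] at *
    rw [lorentzInner_add_right, ha, hb, add_zero]
  smul_mem' := by
    intro c a ha
    simp only [Set.mem_ofPred_eq] at *
    rw [lorentzInner_smul_right, ha, mul_zero]

theorem radius_pos {K : ℝ} (hK : K < 0) : 0 < radius K := by
  have : 0 < √(-K) := Real.sqrt_pos.2 (by linarith)
  simp only [radius]; positivity

theorem radius_sq {K : ℝ} (hK : K < 0) : radius K ^ 2 = -(1 / K) := by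
  rw [radius, div_pow, Real.sq_sqrt (by linarith)]
  rw [one_pow, div_neg]

theorem sum_sq_eq {n : ℕ} {K : ℝ} (hK : K < 0) (x : hyperboloid n K) :
    ∑ i : Fin n, x.1 i.succ ^ 2 = x.1 0 ^ 2 - radius K ^ 2 := by
  have h := x.2.1
  simp only [lorentzInner, ← pow_two] at h
  rw [radius_sq hK]; linarith

/-- Two points of the hyperboloid have negative Lorentz inner product. -/
theorem lorentzInner_neg {n : ℕ} {K : ℝ} (hK : K < 0) (x y : hyperboloid n K) :
    lorentzInner x.1 y.1 < 0 := by
  have hR := radius_pos hK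
  have hx := sum_sq_eq hK x
  have hy := sum_sq_eq hK y
  have hx0 := x.2.2
  have hy0 := y.2.2
  have cs := Finset.sum_mul_sq_le_sq_mul_sq Finset.univ
    (fun i : Fin n => x.1 i.succ) (fun i : Fin n => y.1 i.succ)
  rw [hx, hy] at cs
  have hynn : 0 ≤ y.1 0 ^ 2 - radius K ^ 2 := hy ▸ Finset.sum_nonneg fun i _ => sq_nonneg _
  have hlt : (∑ i : Fin n, x.1 i.succ * y.1 i.succ) ^ 2 < (x.1 0 * y.1 0) ^ 2 := by
    have h1 : 0 < radius K ^ 2 := by positivity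
    have h2 : 0 < x.1 0 ^ 2 := by positivity
    nlinarith [mul_nonneg h1.le hynn, mul_pos h1 h2]
  have := abs_lt_of_sq_lt_sq hlt (by positivity)
  rw [abs_lt] at this
  simp only [lorentzInner]; linarith [this.2]

/-- The quantitative form of the fact that tangent vectors are space-like. -/
theorem tangent_bound {n : ℕ} {K : ℝ} (hK : K < 0) (x : hyperboloid n K)
    (v : tangentSpace x) :
    radius K ^ 2 * v.1 0 ^ 2 ≤ (x.1 0 ^ 2 - radius K ^ 2) * lorentzInner v.1 v.1 := by
  have hx := sum_sq_eq hK x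
  have hv : lorentzInner x.1 v.1 = 0 := v.2
  have cs := Finset.sum_mul_sq_le_sq_mul_sq Finset.univ
    (fun i : Fin n => x.1 i.succ) (fun i : Fin n => v.1 i.succ)
  have h1 : ∑ i : Fin n, x.1 i.succ * v.1 i.succ = x.1 0 * v.1 0 := by
    simp only [lorentzInner] at hv; linarith
  have h2 : lorentzInner v.1 v.1 = -(v.1 0 ^ 2) + ∑ i : Fin n, v.1 i.succ ^ 2 := by
    simp only [lorentzInner, pow_two]
  rw [h1, hx] at cs
  rw [h2]; nlinarith

/-- The Lorentz inner product is nonnegative on tangent spaces. -/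
theorem lorentzInner_self_nonneg {n : ℕ} {K : ℝ} (hK : K < 0) (x : hyperboloid n K)
    (v : tangentSpace x) : 0 ≤ lorentzInner v.1 v.1 := by
  have hb := tangent_bound hK x v
  have hR := radius_pos hK
  have hx := sum_sq_eq hK x
  have hnn : 0 ≤ x.1 0 ^ 2 - radius K ^ 2 := hx ▸ Finset.sum_nonneg fun i _ => sq_nonneg _
  have h2 : lorentzInner v.1 v.1 = -(v.1 0 ^ 2) + ∑ i : Fin n, v.1 i.succ ^ 2 := by
    simp only [lorentzInner, pow_two]
  have h3 : 0 ≤ ∑ i : Fin n, v.1 i.succ ^ 2 := Finset.sum_nonneg fun i _ => sq_nonneg _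
  by_contra! hneg
  have h4 : 0 < v.1 0 ^ 2 := by linarith
  have h5 : 0 < radius K ^ 2 * v.1 0 ^ 2 := by positivity
  nlinarith [mul_nonneg hnn (neg_nonneg.2 hneg.le)]

/-- The exponential map `exp_x^K(v) = cosh(‖v‖/R) x + sinh(‖v‖/R) (R v / ‖v‖)`;
for `v = 0` the second summand is `0`. -/
def expMap {n : ℕ} {K : ℝ} (hK : K < 0) (x : hyperboloid n K) (v : tangentSpace x) :
    hyperboloid n K :=
  ⟨Real.cosh (lorentzNorm v.1 / radius K) • x.1 +
      (Real.sinh (lorentzNorm v.1 / radius K) * (radius K / lorentzNorm v.1)) • v.1, by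
    have hR := radius_pos hK
    have hq := lorentzInner_self_nonneg hK x v
    have hb := tangent_bound hK x v
    have hxx : lorentzInner x.1 x.1 = -radius K ^ 2 := by rw [x.2.1, radius_sq hK]; ring
    have hx0 := x.2.2
    have hxv : lorentzInner x.1 v.1 = 0 := v.2
    have hvx : lorentzInner v.1 x.1 = 0 := by rw [lorentzInner_comm]; exact hxv
    have hr : lorentzNorm v.1 ^ 2 = lorentzInner v.1 v.1 := Real.sq_sqrt hq
    have hr0 : 0 ≤ lorentzNorm v.1 := Real.sqrt_nonneg _
    have hK' : 1 / K = -radius K ^ 2 := by rw [radius_sq hK]; ring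
    rcases hr0.eq_or_lt with h0 | hpos
    · rw [← h0]
      simp
    · set r := lorentzNorm v.1 with hrdef
      set c := Real.cosh (r / radius K) with hc
      set s := Real.sinh (r / radius K) with hs
      have hcs : c ^ 2 = s ^ 2 + 1 := by rw [hc, hs]; exact Real.cosh_sq _
      have hspos : 0 < s := Real.sinh_pos_iff.2 (by positivity)
      have hcpos : 0 < c := Real.cosh_pos _
      constructor
      · rw [lorentzInner_add_right, lorentzInner_smul_right, lorentzInner_smul_right,
          lorentzInner_comm _ x.1, lorentzInner_comm _ v.1, lorentzInner_add_right,
          lorentzInner_add_right, lorentzInner_smul_right, lorentzInner_smul_right,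
          lorentzInner_smul_right, lorentzInner_smul_right, hxx, hxv, hvx, ← hr, hK']
        have h5 : s * (radius K / r) * (s * (radius K / r) * r ^ 2) = s ^ 2 * radius K ^ 2 := by
          field_simp
        linear_combination h5 - radius K ^ 2 * hcs
      · simp only [Pi.add_apply, Pi.smul_apply, smul_eq_mul]
        have h1 : (radius K * v.1 0) ^ 2 ≤ (x.1 0 * r) ^ 2 := by
          rw [mul_pow, mul_pow, hr]
          nlinarith [mul_nonneg (sq_nonneg (radius K)) hq]
        have h2 : |radius K * v.1 0| ≤ x.1 0 * r := abs_le_of_sq_le_sq h1 (by positivity)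
        have h3 : -(x.1 0) ≤ radius K / r * v.1 0 := by
          rw [div_mul_eq_mul_div, le_div_iff₀ hpos]
          linarith [(abs_le.1 h2).1]
        have h4 : s < c := Real.sinh_lt_cosh _
        nlinarith [mul_le_mul_of_nonneg_left h3 hspos.le, mul_pos (sub_pos.2 h4) hx0]⟩

/-- The logarithmic map `log_x^K(y) = arcosh(α) / √(α² - 1) (y - α x)`, `α = K ⟨x, y⟩`;
for `y = x` it is `0`. -/
def logMap {n : ℕ} {K : ℝ} (hK : K < 0) (x y : hyperboloid n K) : tangentSpace x :=
  ⟨(Real.arcosh (K * lorentzInner x.1 y.1) / √((K * lorentzInner x.1 y.1) ^ 2 - 1)) •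
      (y.1 + (-(K * lorentzInner x.1 y.1)) • x.1), by
    refine Submodule.smul_mem _ _ ?_
    change lorentzInner x.1 _ = 0
    rw [lorentzInner_add_right, lorentzInner_smul_right, x.2.1]
    have := hK.ne
    field_simp
    ring⟩

/-- Parallel transport `PT_{x → y}^K(v) = v + ⟨y, v⟩ / (R² - ⟨x, y⟩) (x + y)` along the
geodesic from `x` to `y`. -/
def parallelTransport {n : ℕ} {K : ℝ} (hK : K < 0) (x y : hyperboloid n K)
    (v : tangentSpace x) : tangentSpace y :=
  ⟨v.1 + (lorentzInner y.1 v.1 / (radius K ^ 2 - lorentzInner x.1 y.1)) • (x.1 + y.1), by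
    change lorentzInner y.1 _ = 0
    have h1 := lorentzInner_neg hK x y
    have h2 := radius_pos hK
    have h3 : radius K ^ 2 - lorentzInner x.1 y.1 ≠ 0 := by nlinarith
    have hyy : lorentzInner y.1 y.1 = -radius K ^ 2 := by rw [y.2.1, radius_sq hK]; ring
    rw [lorentzInner_add_right, lorentzInner_smul_right, lorentzInner_add_right, hyy,
      lorentzInner_comm y.1 x.1]
    field_simp
    ring⟩

/-- The origin `μ₀ = (R, 0, …, 0)` of the hyperboloid. -/
def origin (n : ℕ) {K : ℝ} (hK : K < 0) : hyperboloid n K :=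
  ⟨Fin.cons (radius K) 0, by
    have h := radius_sq hK
    refine ⟨?_, by simpa using radius_pos hK⟩
    simp only [lorentzInner, Fin.cons_zero, Fin.cons_succ, Pi.zero_apply, mul_zero,
      Finset.sum_const_zero]
    linarith⟩

/-- The identification of `ℝⁿ` with the tangent space at the origin, `w ↦ (0, w)`. -/
def toTangentOrigin {n : ℕ} {K : ℝ} (hK : K < 0) (w : EuclideanSpace ℝ (Fin n)) :
    tangentSpace (origin n hK) :=
  ⟨Fin.cons 0 w.ofLp, by
    change lorentzInner _ _ = 0
    simp [lorentzInner, origin]⟩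

/-- The coordinates in `ℝⁿ` of a tangent vector `(0, w)` at the origin. -/
def originCoords {n : ℕ} {K : ℝ} (hK : K < 0) (v : tangentSpace (origin n hK)) :
    EuclideanSpace ℝ (Fin n) :=
  WithLp.toLp 2 (Fin.tail v.1)

/-- The density `N(w; 0, S)` of the centred normal distribution on `ℝⁿ` with covariance `S`. -/
def normalPDF {n : ℕ} (S : Matrix (Fin n) (Fin n) ℝ) (w : EuclideanSpace ℝ (Fin n)) : ℝ :=
  (√((2 * Real.pi) ^ n * S.det))⁻¹ * Real.exp (-(1 / 2) * (w.ofLp ⬝ᵥ (S⁻¹.mulVec w.ofLp)))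

/-- The wrapped normal distribution: the law of `exp_μ(PT_{μ₀ → μ}(v))`, where `v` is a centred
Gaussian vector with covariance `S` in the tangent space at the origin. -/
def wrappedNormal {n : ℕ} {K : ℝ} (hK : K < 0) (μ : hyperboloid n K)
    (S : Matrix (Fin n) (Fin n) ℝ) : MeasureTheory.Measure (hyperboloid n K) :=
  (ProbabilityTheory.multivariateGaussian (0 : EuclideanSpace ℝ (Fin n)) S).map fun w =>
    expMap hK μ (parallelTransport hK (origin n hK) μ (toTangentOrigin hK w))

/-- The global parametrization `y ↦ (√(‖y‖² - 1/K), y)` of the hyperboloid, as a map into the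
ambient space. -/
def graphParam {n : ℕ} (K : ℝ) (y : EuclideanSpace ℝ (Fin n)) : Fin (n + 1) → ℝ :=
  Fin.cons (√(‖y‖ ^ 2 - 1 / K)) y.ofLp

/-- The global parametrization as a map onto the hyperboloid. -/
def graphPoint {n : ℕ} {K : ℝ} (hK : K < 0) (y : EuclideanSpace ℝ (Fin n)) :
    hyperboloid n K :=
  ⟨graphParam K y, by
    have h1 : 0 < ‖y‖ ^ 2 - 1 / K := by
      have : 1 / K < 0 := one_div_neg.2 hK
      nlinarith [sq_nonneg ‖y‖]
    refine ⟨?_, by simpa [graphParam] using h1⟩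
    simp only [lorentzInner, graphParam, Fin.cons_zero, Fin.cons_succ]
    rw [Real.mul_self_sqrt h1.le, EuclideanSpace.real_norm_sq_eq]
    simp only [pow_two]
    ring⟩

/-- The matrix of the Riemannian metric, i.e. of the restriction of the Lorentz inner product to
the tangent spaces of the hyperboloid, in the coordinates given by the global parametrization. -/
def metricMatrix {n : ℕ} (K : ℝ) (y : EuclideanSpace ℝ (Fin n)) : Matrix (Fin n) (Fin n) ℝ :=
  Matrix.of fun i j =>
    lorentzInner (fderiv ℝ (graphParam K) y (EuclideanSpace.single i 1))
      (fderiv ℝ (graphParam K) y (EuclideanSpace.single j 1))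

/-- The Riemannian volume measure `√(det g) dy` of the hyperboloid. -/
def riemannianVolume (n : ℕ) {K : ℝ} (hK : K < 0) :
    MeasureTheory.Measure (hyperboloid n K) :=
  ((MeasureTheory.volume : MeasureTheory.Measure (EuclideanSpace ℝ (Fin n))).withDensity
    fun y => ENNReal.ofReal √(metricMatrix K y).det).map (graphPoint hK)

/-- `p` is a continuous density of the measure `P` with respect to the measure `ν`. -/
def IsContinuousDensity {X : Type*} [TopologicalSpace X] [MeasurableSpace X]
    (ν P : MeasureTheory.Measure X) (p : X → ℝ) : Prop :=
  Continuous p ∧ (∀ x, 0 ≤ p x) ∧ P = ν.withDensity fun x => ENNReal.ofReal (p x)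

/-- The function `r ↦ R sinh(r/R) / r`, with its limit `1` as the value at `r = 0`. -/
def sinhRatio (R r : ℝ) : ℝ := if r = 0 then 1 else R * Real.sinh (r / R) / r

end

end HypWN

/-!
Write `F w = exp_μ(PT_{μ₀ → μ}(0, w))` for the wrapping map `wrap`, so that the wrapped normal
distribution is the image under `F` of the Gaussian measure on `ℝⁿ`. Since `exp_μ` and `log_μ` are
inverse to each other, and so are `PT_{μ₀ → μ}` and `PT_{μ → μ₀}`, the map `F` is a bijection onto
the hyperboloid with inverse `unwrap`, which is continuous. The density is therefore the Gaussian
density at `unwrap z`, divided by the Jacobian of `F` with respect to the Riemannian volume.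

For the Jacobian, let `T` be the linear isometry `w ↦ PT_{μ₀ → μ}(0, w)` onto the tangent space at
`μ`, and `s(r) = R sinh(r/R) / r`. In the ambient space `F w = cosh(‖w‖/R) μ + T (s(‖w‖) w)`
(`coe_wrap`), which is differentiable everywhere, the origin included. As `μ` is orthogonal to the
range of `T`, the pullback of the metric under `F` is `s² ⟨h, k⟩ + (1 - s²) ⟨w, h⟩⟨w, k⟩ / ‖w‖²`
(`lorentzInner_wrapDeriv`): the factor is `1` in the radial direction and `s²` in the orthogonal
ones. By the matrix determinant lemma its Gram determinant is `s^(2(n-1))`.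

The Riemannian volume is defined through the graph coordinates. If `Φ` denotes `F` in these
coordinates and `g` the metric matrix, the chain rule gives `det(Φ')² · det g(Φ w) = s^(2(n-1))`
(`det_sq_mul_det_metricMatrix`), so that `det g` need not be computed, and its positivity comes for
free from the surjectivity of `Φ`. The change of variables formula (`map_withDensity_of_bijective`)
then yields the density; it also yields the Lebesgue density of the Gaussian measure, from that of
the standard Gaussian, which is identified by its characteristic function.

Uniqueness holds because two continuous densities agree almost everywhere in the graph coordinates,
hence everywhere.
-/

open MeasureTheory ProbabilityTheory
open scoped ENNReal MatrixOrder RealInnerProductSpace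

/-! ### Densities of images and of Gaussian measures -/

/-- Change of variables for densities; `g` need not be measurable. -/
theorem map_withDensity_of_bijective {E : Type*} [NormedAddCommGroup E] [NormedSpace ℝ E]
    [FiniteDimensional ℝ E] [MeasurableSpace E] [BorelSpace E] (ν : Measure E)
    [ν.IsAddHaarMeasure] {Φ : E → E} {Φ' : E → E →L[ℝ] E}
    (hd : ∀ x, HasFDerivAt Φ (Φ' x) x) (hb : Function.Bijective Φ) (g : E → ℝ≥0∞) :
    (ν.withDensity fun x => ENNReal.ofReal |(Φ' x).det| * g (Φ x)).map Φ = ν.withDensity g := by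
  have hm : Measurable Φ :=
    (continuous_iff_continuousAt.2 fun x => (hd x).continuousAt).measurable
  ext A hA
  rw [Measure.map_apply hm hA, withDensity_apply _ (hm hA), withDensity_apply _ hA,
    ← lintegral_image_eq_lintegral_abs_det_fderiv_mul ν (hm hA)
      (fun x _ => (hd x).hasFDerivWithinAt) hb.1.injOn, Set.image_preimage_eq _ hb.2]

theorem stdGaussian_eq_withDensity (n : ℕ) :
    stdGaussian (EuclideanSpace ℝ (Fin n)) =
      volume.withDensity fun x => ENNReal.ofReal
        ((√((2 * Real.pi) ^ n))⁻¹ * Real.exp (-(1 / 2) * ‖x‖ ^ 2)) := by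
  have hpi := Real.pi_pos
  have hint : Integrable (fun x : EuclideanSpace ℝ (Fin n) =>
      (√((2 * Real.pi) ^ n))⁻¹ * Real.exp (-(1 / 2) * ‖x‖ ^ 2)) := by
    have h := (GaussianFourier.integrable_cexp_neg_mul_sq_norm_add (b := 1 / 2) (by norm_num) 0
      (0 : EuclideanSpace ℝ (Fin n))).norm.const_mul (√((2 * Real.pi) ^ n))⁻¹
    refine h.congr (Filter.Eventually.of_forall fun x => ?_)
    simp only [Complex.norm_exp]
    congr 2
    simp [← Complex.ofReal_pow]
  have : IsFiniteMeasure ((volume : Measure (EuclideanSpace ℝ (Fin n))).withDensity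
      fun x => ENNReal.ofReal ((√((2 * Real.pi) ^ n))⁻¹ * Real.exp (-(1 / 2) * ‖x‖ ^ 2))) :=
    isFiniteMeasure_withDensity_ofReal hint.2
  refine Measure.ext_of_charFun ?_
  ext t
  rw [charFun_stdGaussian, charFun_apply, integral_withDensity_eq_integral_toReal_smul
    (by fun_prop) (Filter.Eventually.of_forall fun x => ENNReal.ofReal_lt_top)]
  have h := GaussianFourier.integral_cexp_neg_mul_sq_norm_add (b := 1 / 2) (by norm_num) Complex.I t
  have hc : ((Real.pi : ℂ) / (1 / 2)) ^ (Module.finrank ℝ (EuclideanSpace ℝ (Fin n)) / 2 : ℂ)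
      = ((√((2 * Real.pi) ^ n) : ℝ) : ℂ) := by
    rw [finrank_euclideanSpace_fin, Real.sqrt_eq_rpow, ← Real.rpow_natCast, ← Real.rpow_mul
      (by positivity), Complex.ofReal_cpow (by positivity)]
    push_cast
    congr 1 <;> ring
  rw [hc] at h
  have hne : √((2 * Real.pi) ^ n) ≠ 0 := by positivity
  calc _ = Complex.exp (Complex.I ^ 2 * ‖t‖ ^ 2 / (4 * (1 / 2))) := by
        rw [Complex.I_sq]; congr 1; ring
    _ = ((√((2 * Real.pi) ^ n))⁻¹ : ℝ) * ∫ x : EuclideanSpace ℝ (Fin n),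
          Complex.exp (-(1 / 2) * ‖x‖ ^ 2 + Complex.I * ⟪t, x⟫) := by
        rw [h, ← mul_assoc, ← Complex.ofReal_mul, inv_mul_cancel₀ hne]; simp
    _ = _ := by
        rw [← integral_const_mul]
        refine integral_congr_ae (Filter.Eventually.of_forall fun x => ?_)
        simp only
        rw [ENNReal.toReal_ofReal (by positivity), Complex.exp_add, Complex.real_smul,
          real_inner_comm, mul_comm Complex.I]
        push_cast
        ring

theorem det_toEuclideanCLM {n : ℕ} (A : Matrix (Fin n) (Fin n) ℝ) :
    (Matrix.toEuclideanCLM (n := Fin n) (𝕜 := ℝ) A).det = A.det :=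
  LinearMap.det_toLin (EuclideanSpace.basisFun (Fin n) ℝ).toBasis A

theorem mulVec_dotProduct_inv_mulVec_mulVec {m : Type*} [Fintype m] [DecidableEq m]
    {A : Matrix m m ℝ} (hA : A.det ≠ 0) (hAT : A.transpose = A) (x : m → ℝ) :
    A.mulVec x ⬝ᵥ (A * A)⁻¹.mulVec (A.mulVec x) = x ⬝ᵥ x := by
  have h4 : (A * A)⁻¹.mulVec (A.mulVec x) = A⁻¹.mulVec x := by
    rw [Matrix.mul_inv_rev, Matrix.mulVec_mulVec, Matrix.mul_assoc,
      Matrix.nonsing_inv_mul _ hA.isUnit, Matrix.mul_one]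
  rw [h4]
  nth_rw 1 [← hAT]
  rw [Matrix.mulVec_transpose, ← Matrix.dotProduct_mulVec, Matrix.mulVec_mulVec,
    Matrix.mul_nonsing_inv _ hA.isUnit, Matrix.one_mulVec]

/-- The change of variables that turns the standard Gaussian into the one with covariance
`A * A`; it is applied to the square root `A` of a covariance matrix. -/
theorem normalPDF_mul_self_comp {n : ℕ} {A : Matrix (Fin n) (Fin n) ℝ} (hA : A.det ≠ 0)
    (hAT : A.transpose = A) (x : EuclideanSpace ℝ (Fin n)) :
    |A.det| * HypWN.normalPDF (A * A) (Matrix.toEuclideanCLM (n := Fin n) (𝕜 := ℝ) A x) =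
      (√((2 * Real.pi) ^ n))⁻¹ * Real.exp (-(1 / 2) * ‖x‖ ^ 2) := by
  have h1 : √((2 * Real.pi) ^ n * (A * A).det) = √((2 * Real.pi) ^ n) * |A.det| := by
    rw [Real.sqrt_mul (by positivity), Matrix.det_mul, Real.sqrt_mul_self_eq_abs]
  have h2 : x.ofLp ⬝ᵥ x.ofLp = ‖x‖ ^ 2 := by
    rw [EuclideanSpace.real_norm_sq_eq]
    simp [dotProduct, pow_two]
  have h3 : |A.det| ≠ 0 := abs_ne_zero.2 hA
  rw [HypWN.normalPDF, Matrix.ofLp_toEuclideanCLM,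
    mulVec_dotProduct_inv_mulVec_mulVec hA hAT, h1, h2, mul_inv, ← mul_assoc, mul_left_comm,
    mul_inv_cancel₀ h3, mul_one]

theorem bijective_toEuclideanCLM {n : ℕ} {A : Matrix (Fin n) (Fin n) ℝ} (hA : A.det ≠ 0) :
    Function.Bijective (Matrix.toEuclideanCLM (n := Fin n) (𝕜 := ℝ) A) := by
  refine (Module.End.isUnit_iff (Matrix.toEuclideanCLM (n := Fin n) (𝕜 := ℝ) A :
    EuclideanSpace ℝ (Fin n) →ₗ[ℝ] EuclideanSpace ℝ (Fin n))).1 ?_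
  rw [LinearMap.isUnit_iff_isUnit_det]
  have h := hA.isUnit
  rw [← det_toEuclideanCLM A] at h
  exact h

theorem multivariateGaussian_eq_withDensity {n : ℕ} {S : Matrix (Fin n) (Fin n) ℝ}
    (hS : S.PosDef) :
    multivariateGaussian (0 : EuclideanSpace ℝ (Fin n)) S =
      volume.withDensity fun w => ENNReal.ofReal (HypWN.normalPDF S w) := by
  have hAA : CFC.sqrt S * CFC.sqrt S = S := CFC.sqrt_mul_sqrt_self S hS.posSemidef.nonneg
  have hAT : (CFC.sqrt S).transpose = CFC.sqrt S := by
    have := (CFC.sqrt_nonneg S).isSelfAdjoint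
    simpa [IsSelfAdjoint, Matrix.star_eq_conjTranspose] using this
  have hAd : (CFC.sqrt S).det ≠ 0 := by
    intro h
    have := hS.det_pos
    rw [← hAA, Matrix.det_mul, h] at this
    simp at this
  have key := map_withDensity_of_bijective volume (Φ' := fun _ => Matrix.toEuclideanCLM
      (n := Fin n) (𝕜 := ℝ) (CFC.sqrt S)) (fun x => ContinuousLinearMap.hasFDerivAt _)
    (bijective_toEuclideanCLM hAd) (fun w => ENNReal.ofReal (HypWN.normalPDF S w))
  have hdens : ∀ x : EuclideanSpace ℝ (Fin n),
      ENNReal.ofReal ((√((2 * Real.pi) ^ n))⁻¹ * Real.exp (-(1 / 2) * ‖x‖ ^ 2)) =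
      ENNReal.ofReal |(CFC.sqrt S).det| * ENNReal.ofReal (HypWN.normalPDF S
        (Matrix.toEuclideanCLM (n := Fin n) (𝕜 := ℝ) (CFC.sqrt S) x)) := by
    intro x
    rw [← ENNReal.ofReal_mul (abs_nonneg _), ← normalPDF_mul_self_comp hAd hAT, hAA]
  rw [multivariateGaussian, stdGaussian_eq_withDensity, ← key]
  simp only [zero_add, hdens, det_toEuclideanCLM]

namespace HypWN

variable {n : ℕ} {K : ℝ}

/-! ### Exponential map, logarithm and parallel transport -/

theorem lorentzInner_add_left (x y z : Fin (n + 1) → ℝ) :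
    lorentzInner (x + y) z = lorentzInner x z + lorentzInner y z := by
  simp only [lorentzInner_comm _ z, lorentzInner_add_right]

theorem lorentzInner_smul_left (c : ℝ) (x y : Fin (n + 1) → ℝ) :
    lorentzInner (c • x) y = c * lorentzInner x y := by
  simp only [lorentzInner_comm _ y, lorentzInner_smul_right]

theorem lorentzInner_self_eq (hK : K < 0) (x : hyperboloid n K) :
    lorentzInner x.1 x.1 = -radius K ^ 2 := by rw [x.2.1, radius_sq hK]; ring

theorem mul_radius_sq (hK : K < 0) : K * radius K ^ 2 = -1 := by
  rw [radius_sq hK]; field_simp [hK.ne]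

/-- The Lorentz inner product is definite on tangent spaces. -/
theorem eq_zero_of_lorentzInner_self_eq_zero (hK : K < 0) (x : hyperboloid n K)
    {v : tangentSpace x} (h : lorentzInner v.1 v.1 = 0) : v.1 = 0 := by
  have hb := tangent_bound hK x v
  rw [h, mul_zero] at hb
  have hR : 0 < radius K ^ 2 := pow_pos (radius_pos hK) 2
  have h0 : v.1 0 = 0 := by
    have h1 := sq_nonneg (v.1 0)
    have : v.1 0 ^ 2 = 0 := by nlinarith
    exact pow_eq_zero_iff two_ne_zero |>.1 this
  have h3 : ∑ i : Fin n, v.1 i.succ * v.1 i.succ = 0 := by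
    simpa [lorentzInner, h0] using h
  rw [Finset.sum_eq_zero_iff_of_nonneg fun i _ => mul_self_nonneg _] at h3
  funext i
  refine Fin.cases h0 (fun j => ?_) i
  simpa using h3 j (Finset.mem_univ _)

theorem lorentzNorm_sq (hK : K < 0) (x : hyperboloid n K) (v : tangentSpace x) :
    lorentzNorm v.1 ^ 2 = lorentzInner v.1 v.1 :=
  Real.sq_sqrt (lorentzInner_self_nonneg hK x v)

theorem eq_zero_of_lorentzNorm_eq_zero (hK : K < 0) (x : hyperboloid n K)
    {v : tangentSpace x} (h : lorentzNorm v.1 = 0) : v = 0 :=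
  Subtype.ext (eq_zero_of_lorentzInner_self_eq_zero hK x (by rw [← lorentzNorm_sq hK, h]; simp))

theorem lorentzInner_sub_smul_self (hK : K < 0) (x y : hyperboloid n K) :
    lorentzInner (y.1 + (-(K * lorentzInner x.1 y.1)) • x.1)
      (y.1 + (-(K * lorentzInner x.1 y.1)) • x.1) =
      radius K ^ 2 * ((K * lorentzInner x.1 y.1) ^ 2 - 1) := by
  simp only [lorentzInner_add_left, lorentzInner_add_right, lorentzInner_smul_left,
    lorentzInner_smul_right, lorentzInner_self_eq hK, lorentzInner_comm y.1 x.1]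
  linear_combination (-2 * K * lorentzInner x.1 y.1 ^ 2) * mul_radius_sq hK

theorem sub_smul_mem_tangentSpace (hK : K < 0) (x y : hyperboloid n K) :
    y.1 + (-(K * lorentzInner x.1 y.1)) • x.1 ∈ tangentSpace x := by
  change lorentzInner x.1 _ = 0
  rw [lorentzInner_add_right, lorentzInner_smul_right, lorentzInner_self_eq hK]
  linear_combination (lorentzInner x.1 y.1) * mul_radius_sq hK

/-- The reversed Cauchy-Schwarz inequality on the hyperboloid. -/
theorem one_le_mul_lorentzInner (hK : K < 0) (x y : hyperboloid n K) :
    1 ≤ K * lorentzInner x.1 y.1 := by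
  have h := lorentzInner_self_nonneg hK x ⟨_, sub_smul_mem_tangentSpace hK x y⟩
  rw [lorentzInner_sub_smul_self hK] at h
  have hR : 0 < radius K ^ 2 := pow_pos (radius_pos hK) 2
  have h1 : 0 < K * lorentzInner x.1 y.1 := mul_pos_of_neg_of_neg hK (lorentzInner_neg hK x y)
  have h2 := nonneg_of_mul_nonneg_right h hR
  nlinarith

/-- The norm of `log_x(y)` is the geodesic distance of `x` and `y`. -/
theorem lorentzNorm_logMap (hK : K < 0) (x y : hyperboloid n K) :
    lorentzNorm (logMap hK x y).1 = radius K * Real.arcosh (K * lorentzInner x.1 y.1) := by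
  have h1 := one_le_mul_lorentzInner hK x y
  have ht := Real.arcosh_nonneg h1
  have hR := radius_pos hK
  simp only [lorentzNorm, logMap, lorentzInner_smul_left, lorentzInner_smul_right,
    lorentzInner_sub_smul_self hK]
  set α := K * lorentzInner x.1 y.1
  rcases h1.eq_or_lt with h | h
  · rw [← h]; simp
  · have h2 : 0 < α ^ 2 - 1 := by nlinarith
    rw [Real.sqrt_eq_iff_mul_self_eq (by positivity) (by positivity)]
    have h3 := Real.sq_sqrt h2.le
    have h4 := (Real.sqrt_pos.2 h2).ne'
    field_simp
    rw [h3]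

theorem expMap_logMap (hK : K < 0) (x y : hyperboloid n K) :
    expMap hK x (logMap hK x y) = y := by
  have h1 := one_le_mul_lorentzInner hK x y
  have hR := radius_pos hK
  apply Subtype.ext
  simp only [expMap]
  rw [lorentzNorm_logMap hK, mul_div_cancel_left₀ _ hR.ne', Real.cosh_arcosh h1,
    Real.sinh_arcosh h1]
  rcases h1.eq_or_lt with h | h
  · have h2 := lorentzInner_sub_smul_self hK x y
    have h3 := eq_zero_of_lorentzInner_self_eq_zero hK x
      (v := ⟨_, sub_smul_mem_tangentSpace hK x y⟩) (by rw [h2, ← h]; ring)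
    simp only [← h, neg_smul, one_smul, ← sub_eq_add_neg, sub_eq_zero] at h3 ⊢
    simp [h3]
  · have h2 := (Real.sqrt_pos.2 (by nlinarith : 0 < (K * lorentzInner x.1 y.1) ^ 2 - 1)).ne'
    have h3 := (Real.arcosh_pos h).ne'
    simp only [logMap]
    generalize K * lorentzInner x.1 y.1 = α at h2 h3 ⊢
    rw [smul_smul]
    have : √(α ^ 2 - 1) * (radius K / (radius K * Real.arcosh α)) *
        (Real.arcosh α / √(α ^ 2 - 1)) = 1 := by
      generalize √(α ^ 2 - 1) = s at h2 ⊢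
      field_simp
    rw [this]
    module

theorem mul_lorentzInner_expMap (hK : K < 0) (x : hyperboloid n K) (v : tangentSpace x) :
    K * lorentzInner x.1 (expMap hK x v).1 = Real.cosh (lorentzNorm v.1 / radius K) := by
  have hv : lorentzInner x.1 v.1 = 0 := v.2
  simp only [expMap, lorentzInner_add_right, lorentzInner_smul_right, hv, lorentzInner_self_eq hK]
  linear_combination -Real.cosh (lorentzNorm v.1 / radius K) * mul_radius_sq hK

theorem logMap_expMap (hK : K < 0) (x : hyperboloid n K) (v : tangentSpace x) :
    logMap hK x (expMap hK x v) = v := by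
  have hR := radius_pos hK
  have hr0 : 0 ≤ lorentzNorm v.1 := Real.sqrt_nonneg _
  apply Subtype.ext
  simp only [logMap, mul_lorentzInner_expMap hK, Real.arcosh_cosh (div_nonneg hr0 hR.le)]
  rcases hr0.eq_or_lt with h | h
  · rw [eq_zero_of_lorentzNorm_eq_zero hK x h.symm]
    simp [lorentzNorm, lorentzInner]
  · have h2 : 0 < Real.sinh (lorentzNorm v.1 / radius K) := Real.sinh_pos_iff.2 (by positivity)
    rw [Real.cosh_sq, add_sub_cancel_right, Real.sqrt_sq h2.le]
    simp only [expMap]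
    rw [add_comm (_ • x.1), add_assoc, ← add_smul, add_neg_cancel, zero_smul, add_zero, smul_smul]
    have : lorentzNorm v.1 / radius K / Real.sinh (lorentzNorm v.1 / radius K) *
      (Real.sinh (lorentzNorm v.1 / radius K) * (radius K / lorentzNorm v.1)) = 1 := by
      field_simp
    rw [this, one_smul]

theorem radius_sq_sub_lorentzInner_pos (hK : K < 0) (x y : hyperboloid n K) :
    0 < radius K ^ 2 - lorentzInner x.1 y.1 := by
  have := lorentzInner_neg hK x y
  have := sq_nonneg (radius K)
  linarith

/-- Parallel transport is isometric. -/
theorem lorentzInner_parallelTransport (hK : K < 0) (x y : hyperboloid n K)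
    (v w : tangentSpace x) :
    lorentzInner (parallelTransport hK x y v).1 (parallelTransport hK x y w).1 =
      lorentzInner v.1 w.1 := by
  have hv : lorentzInner x.1 v.1 = 0 := v.2
  have hw : lorentzInner x.1 w.1 = 0 := w.2
  have hne := (radius_sq_sub_lorentzInner_pos hK x y).ne'
  simp only [parallelTransport, lorentzInner_add_left, lorentzInner_add_right,
    lorentzInner_smul_left, lorentzInner_smul_right, lorentzInner_self_eq hK,
    lorentzInner_comm y.1 x.1, lorentzInner_comm v.1 x.1, lorentzInner_comm v.1 y.1, hv, hw]
  field_simp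
  ring

theorem parallelTransport_parallelTransport (hK : K < 0) (x y : hyperboloid n K)
    (v : tangentSpace x) : parallelTransport hK y x (parallelTransport hK x y v) = v := by
  have hv : lorentzInner x.1 v.1 = 0 := v.2
  have hne := (radius_sq_sub_lorentzInner_pos hK x y).ne'
  apply Subtype.ext
  simp only [parallelTransport, lorentzInner_add_right, lorentzInner_smul_right,
    lorentzInner_self_eq hK, lorentzInner_comm y.1 x.1, hv]
  have : (0 + lorentzInner y.1 v.1 / (radius K ^ 2 - lorentzInner x.1 y.1) *
      (-radius K ^ 2 + lorentzInner x.1 y.1)) / (radius K ^ 2 - lorentzInner x.1 y.1) =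
      -(lorentzInner y.1 v.1 / (radius K ^ 2 - lorentzInner x.1 y.1)) := by
    field_simp; ring
  rw [this]
  module

theorem originCoords_toTangentOrigin (hK : K < 0) (w : EuclideanSpace ℝ (Fin n)) :
    originCoords hK (toTangentOrigin hK w) = w := by
  simp [originCoords, toTangentOrigin]

theorem toTangentOrigin_originCoords (hK : K < 0) (v : tangentSpace (origin n hK)) :
    toTangentOrigin hK (originCoords hK v) = v := by
  have hv : lorentzInner (origin n hK).1 v.1 = 0 := v.2
  have h0 : v.1 0 = 0 := by
    simpa [lorentzInner, origin, (radius_pos hK).ne'] using hv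
  apply Subtype.ext
  simp only [originCoords, toTangentOrigin]
  rw [← h0, Fin.cons_self_tail]

theorem lorentzInner_toTangentOrigin (hK : K < 0) (v w : EuclideanSpace ℝ (Fin n)) :
    lorentzInner (toTangentOrigin hK v).1 (toTangentOrigin hK w).1 = ⟪v, w⟫ := by
  simp [toTangentOrigin, lorentzInner, PiLp.inner_apply, mul_comm]

/-! ### The wrapping map -/

/-- The wrapping map `w ↦ exp_μ(PT_{μ₀ → μ}(0, w))`. -/
noncomputable def wrap (hK : K < 0) (μ : hyperboloid n K) (w : EuclideanSpace ℝ (Fin n)) :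
    hyperboloid n K :=
  expMap hK μ (parallelTransport hK (origin n hK) μ (toTangentOrigin hK w))

/-- The inverse of the wrapping map, `z ↦ PT_{μ → μ₀}(log_μ z)`. -/
noncomputable def unwrap (hK : K < 0) (μ z : hyperboloid n K) : EuclideanSpace ℝ (Fin n) :=
  originCoords hK (parallelTransport hK μ (origin n hK) (logMap hK μ z))

theorem unwrap_wrap (hK : K < 0) (μ : hyperboloid n K) (w : EuclideanSpace ℝ (Fin n)) :
    unwrap hK μ (wrap hK μ w) = w := by
  rw [unwrap, wrap, logMap_expMap, parallelTransport_parallelTransport,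
    originCoords_toTangentOrigin]

theorem wrap_unwrap (hK : K < 0) (μ z : hyperboloid n K) :
    wrap hK μ (unwrap hK μ z) = z := by
  rw [unwrap, wrap, toTangentOrigin_originCoords, parallelTransport_parallelTransport,
    expMap_logMap]

theorem norm_unwrap (hK : K < 0) (μ z : hyperboloid n K) :
    ‖unwrap hK μ z‖ = lorentzNorm (logMap hK μ z).1 := by
  rw [lorentzNorm, ← lorentzInner_parallelTransport hK μ (origin n hK),
    ← toTangentOrigin_originCoords hK (parallelTransport hK μ (origin n hK) (logMap hK μ z)),
    lorentzInner_toTangentOrigin, real_inner_self_eq_norm_sq, Real.sqrt_sq (norm_nonneg _), unwrap]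

end HypWN

/-! ### Derivatives of radial maps -/

section Radial

variable {E : Type*} [NormedAddCommGroup E] [InnerProductSpace ℝ E]

/-- Radial functions are differentiable, even at the origin if the profile has derivative `0`
there; the formula remains valid because `innerSL ℝ 0 = 0`. -/
theorem HasDerivAt.hasFDerivAt_comp_norm {f : ℝ → ℝ} {f' : ℝ} {w : E}
    (hf : HasDerivAt f f' ‖w‖) (h0 : w = 0 → f' = 0) :
    HasFDerivAt (fun w : E => f ‖w‖) ((f' / ‖w‖) • innerSL ℝ w) w := by
  rcases eq_or_ne w 0 with rfl | hw
  · rw [h0 rfl, norm_zero] at hf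
    have h1 := hasDerivAt_iff_isLittleO_nhds_zero.1 hf
    rw [hasFDerivAt_iff_isLittleO_nhds_zero]
    have h2 := h1.comp_tendsto (tendsto_norm_zero (E := E))
    have h3 := Asymptotics.isLittleO_norm_right.1 h2
    simpa [Function.comp_def] using h3
  · have h1 : HasFDerivAt (fun w : E => √(‖w‖ ^ 2))
        ((1 / (2 * √(‖w‖ ^ 2))) • (2 • innerSL ℝ w)) w :=
      (hasStrictFDerivAt_norm_sq w).hasFDerivAt.sqrt (by positivity)
    simp only [Real.sqrt_sq (norm_nonneg _)] at h1
    refine (hf.comp_hasFDerivAt w h1).congr_fderiv ?_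
    ext v
    have := norm_ne_zero_iff.2 hw
    simp
    field_simp

/-- The derivative of a radial rescaling. At the origin continuity of the profile suffices; the
second summand is `0` there since `f' / 0 = 0`. -/
theorem HasDerivAt.hasFDerivAt_norm_smul_self {f : ℝ → ℝ} {f' : ℝ} {w : E}
    (hc : ContinuousAt f 0) (hf : w ≠ 0 → HasDerivAt f f' ‖w‖) :
    HasFDerivAt (fun w : E => f ‖w‖ • w)
      (f ‖w‖ • ContinuousLinearMap.id ℝ E + ((f' / ‖w‖) • innerSL ℝ w).smulRight w) w := by
  rcases eq_or_ne w 0 with rfl | hw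
  · rw [hasFDerivAt_iff_isLittleO_nhds_zero]
    have h1 : Filter.Tendsto (fun h : E => f ‖h‖ - f 0) (nhds 0) (nhds 0) := by
      have := (hc.tendsto.comp (tendsto_norm_zero (E := E))).sub_const (f 0)
      simpa [Function.comp_def] using this
    have h2 := ((Asymptotics.isLittleO_one_iff ℝ).2 h1).smul_isBigO
      (Asymptotics.isBigO_refl (fun h : E => h) (nhds 0))
    simpa [sub_smul] using h2
  · have h1 := (hf hw).hasFDerivAt_comp_norm (fun h => absurd h hw)
    exact h1.smul (hasFDerivAt_id w)

end Radial

namespace HypWN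

variable {n : ℕ} {K : ℝ}

/-! ### The function `sinhRatio` -/

/-- `sinhRatio R` is a difference quotient completed by the derivative; hence its continuity. -/
theorem sinhRatio_eq_dslope (R : ℝ) (hR : R ≠ 0) :
    sinhRatio R = dslope (fun r => R * Real.sinh (r / R)) 0 := by
  funext r
  rcases eq_or_ne r 0 with rfl | hr
  · have : HasDerivAt (fun r => R * Real.sinh (r / R)) 1 0 := by
      have := ((hasDerivAt_id (0 : ℝ)).div_const R).sinh.const_mul R
      simpa [hR] using this
    rw [dslope_same, this.deriv, sinhRatio, if_pos rfl]
  · rw [dslope_of_ne _ hr, slope_def_field, sinhRatio, if_neg hr]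
    simp

theorem continuous_sinhRatio {R : ℝ} (hR : R ≠ 0) : Continuous (sinhRatio R) := by
  rw [sinhRatio_eq_dslope R hR, continuous_iff_continuousAt]
  intro r
  rcases eq_or_ne r 0 with rfl | hr
  · exact continuousAt_dslope_same.2 (by fun_prop)
  · exact (continuousAt_dslope_of_ne hr).2 (by fun_prop)

theorem sinhRatio_pos {R r : ℝ} (hR : 0 < R) (hr : 0 ≤ r) : 0 < sinhRatio R r := by
  unfold sinhRatio
  split_ifs with h
  · exact one_pos
  · have : 0 < r := lt_of_le_of_ne hr (Ne.symm h)
    have : 0 < Real.sinh (r / R) := Real.sinh_pos_iff.2 (by positivity)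
    positivity

theorem hasDerivAt_sinhRatio {R r : ℝ} (hR : R ≠ 0) (hr : r ≠ 0) :
    HasDerivAt (sinhRatio R) ((Real.cosh (r / R) - sinhRatio R r) / r) r := by
  have h := (((hasDerivAt_id r).div_const R).sinh.const_mul R).div (hasDerivAt_id r) hr
  refine (h.congr_of_eventuallyEq ?_).congr_deriv ?_
  · filter_upwards [eventually_ne_nhds hr] with x hx
    simp [sinhRatio, hx]
  · simp only [sinhRatio, if_neg hr, id]
    field_simp

/-! ### The derivative of the wrapping map -/

/-- Parallel transport from the origin to `μ`, as a linear map from `ℝⁿ` to the ambient space. -/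
noncomputable def transport (hK : K < 0) (μ : hyperboloid n K) :
    EuclideanSpace ℝ (Fin n) →L[ℝ] (Fin (n + 1) → ℝ) :=
  LinearMap.toContinuousLinearMap
    { toFun := fun w => (parallelTransport hK (origin n hK) μ (toTangentOrigin hK w)).1
      map_add' := fun v w => by
        have : (toTangentOrigin hK (v + w)).1 =
            (toTangentOrigin hK v).1 + (toTangentOrigin hK w).1 := by
          simp only [toTangentOrigin]
          funext i
          refine Fin.cases ?_ (fun j => ?_) i <;> simp
        simp only [parallelTransport, this, lorentzInner_add_right, add_div, add_smul]
        abel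
      map_smul' := fun c w => by
        have : (toTangentOrigin hK (c • w)).1 = c • (toTangentOrigin hK w).1 := by
          simp only [toTangentOrigin]
          funext i
          refine Fin.cases ?_ (fun j => ?_) i <;> simp
        simp only [parallelTransport, this, lorentzInner_smul_right, mul_div_assoc,
          RingHom.id_apply, smul_add, smul_smul] }

theorem transport_apply (hK : K < 0) (μ : hyperboloid n K) (w : EuclideanSpace ℝ (Fin n)) :
    transport hK μ w = (parallelTransport hK (origin n hK) μ (toTangentOrigin hK w)).1 := rfl

theorem lorentzInner_transport (hK : K < 0) (μ : hyperboloid n K)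
    (v w : EuclideanSpace ℝ (Fin n)) :
    lorentzInner (transport hK μ v) (transport hK μ w) = ⟪v, w⟫ := by
  rw [transport_apply, transport_apply, lorentzInner_parallelTransport,
    lorentzInner_toTangentOrigin]

theorem lorentzInner_transport_right (hK : K < 0) (μ : hyperboloid n K)
    (w : EuclideanSpace ℝ (Fin n)) : lorentzInner μ.1 (transport hK μ w) = 0 :=
  (parallelTransport hK (origin n hK) μ (toTangentOrigin hK w)).2

/-- The wrapping map in the ambient space, in a form that is differentiable at `0` too. -/
theorem coe_wrap (hK : K < 0) (μ : hyperboloid n K) (w : EuclideanSpace ℝ (Fin n)) :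
    (wrap hK μ w).1 = Real.cosh (‖w‖ / radius K) • μ.1 +
      transport hK μ (sinhRatio (radius K) ‖w‖ • w) := by
  have hnorm : lorentzNorm (transport hK μ w) = ‖w‖ := by
    rw [lorentzNorm, lorentzInner_transport, real_inner_self_eq_norm_sq,
      Real.sqrt_sq (norm_nonneg _)]
  simp only [wrap, expMap, ← transport_apply, hnorm, map_smul]
  rcases eq_or_ne w 0 with rfl | hw
  · simp
  · rw [sinhRatio, if_neg (norm_ne_zero_iff.2 hw)]
    congr 2
    ring

/-- The derivative of the wrapping map, as a map into the ambient space. At `w = 0` the quotients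
by `‖w‖` have the value `0`, and the formula gives the correct derivative `transport hK μ`. -/
noncomputable def wrapDeriv (hK : K < 0) (μ : hyperboloid n K) (w : EuclideanSpace ℝ (Fin n)) :
    EuclideanSpace ℝ (Fin n) →L[ℝ] (Fin (n + 1) → ℝ) :=
  ((Real.sinh (‖w‖ / radius K) / radius K / ‖w‖) • innerSL ℝ w).smulRight μ.1 +
    (transport hK μ).comp (sinhRatio (radius K) ‖w‖ • ContinuousLinearMap.id ℝ _ +
      (((Real.cosh (‖w‖ / radius K) - sinhRatio (radius K) ‖w‖) / ‖w‖ / ‖w‖) •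
        innerSL ℝ w).smulRight w)

theorem hasFDerivAt_wrap (hK : K < 0) (μ : hyperboloid n K) (w : EuclideanSpace ℝ (Fin n)) :
    HasFDerivAt (fun w => (wrap hK μ w).1) (wrapDeriv hK μ w) w := by
  have hR := (radius_pos hK).ne'
  simp only [coe_wrap]
  refine HasFDerivAt.add ?_ ((transport hK μ).hasFDerivAt.comp w ?_)
  · refine HasFDerivAt.smul_const (HasDerivAt.hasFDerivAt_comp_norm
      (f := fun r => Real.cosh (r / radius K)) ?_ ?_) μ.1
    · simpa [div_eq_mul_inv] using ((hasDerivAt_id ‖w‖).div_const (radius K)).cosh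
    · rintro rfl; simp
  · exact HasDerivAt.hasFDerivAt_norm_smul_self (continuous_sinhRatio hR).continuousAt
      fun hw => hasDerivAt_sinhRatio hR (norm_ne_zero_iff.2 hw)

/-- The metric in normal coordinates: the factor is `1` in the radial direction and `sinhRatio²` in
the orthogonal directions. -/
theorem lorentzInner_wrapDeriv (hK : K < 0) (μ : hyperboloid n K)
    (w h k : EuclideanSpace ℝ (Fin n)) :
    lorentzInner (wrapDeriv hK μ w h) (wrapDeriv hK μ w k) =
      sinhRatio (radius K) ‖w‖ ^ 2 * ⟪h, k⟫ +
        (1 - sinhRatio (radius K) ‖w‖ ^ 2) / ‖w‖ ^ 2 * (⟪w, h⟫ * ⟪w, k⟫) := by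
  have hR := (radius_pos hK).ne'
  have e : ∀ h, wrapDeriv hK μ w h =
      ((Real.sinh (‖w‖ / radius K) / radius K / ‖w‖) * ⟪w, h⟫) • μ.1 + transport hK μ
        (sinhRatio (radius K) ‖w‖ • h +
          (((Real.cosh (‖w‖ / radius K) - sinhRatio (radius K) ‖w‖) / ‖w‖ / ‖w‖) * ⟪w, h⟫) • w) :=
    fun h => by simp [wrapDeriv]
  simp only [e, lorentzInner_add_left, lorentzInner_add_right, lorentzInner_smul_left,
    lorentzInner_smul_right, lorentzInner_transport, lorentzInner_transport_right,
    lorentzInner_comm _ μ.1, lorentzInner_self_eq hK, inner_add_left, inner_add_right,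
    real_inner_smul_left, real_inner_smul_right, real_inner_self_eq_norm_sq,
    real_inner_comm w h]
  rcases eq_or_ne w 0 with rfl | hw
  · simp; ring
  · have hr := norm_ne_zero_iff.2 hw
    have hcs := Real.cosh_sq (‖w‖ / radius K)
    rw [sinhRatio, if_neg hr]
    generalize Real.cosh (‖w‖ / radius K) = c at hcs ⊢
    generalize Real.sinh (‖w‖ / radius K) = s at hcs ⊢
    generalize ⟪w, h⟫ = a
    generalize ⟪w, k⟫ = b
    generalize ⟪h, k⟫ = d
    generalize ‖w‖ = r at hr ⊢
    generalize radius K = R at hR ⊢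
    field_simp
    linear_combination (r ^ 2 * R * a * b) * hcs

/-- The Gram determinant of the wrapping map. The truncated exponent `n - 1` is harmless: for
`n = 0` the only vector is `w = 0`, where `sinhRatio` has the value `1`. -/
theorem det_gram_wrapDeriv (hK : K < 0) (μ : hyperboloid n K) (w : EuclideanSpace ℝ (Fin n)) :
    (Matrix.of fun i j => lorentzInner (wrapDeriv hK μ w (EuclideanSpace.single i 1))
      (wrapDeriv hK μ w (EuclideanSpace.single j 1))).det =
      (sinhRatio (radius K) ‖w‖ ^ (n - 1)) ^ 2 := by
  set s := sinhRatio (radius K) ‖w‖ with hs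
  have hspos : 0 < s := sinhRatio_pos (radius_pos hK) (norm_nonneg _)
  have hM : (Matrix.of fun i j => lorentzInner (wrapDeriv hK μ w (EuclideanSpace.single i 1))
      (wrapDeriv hK μ w (EuclideanSpace.single j 1))) = s ^ 2 • (1 +
        Matrix.replicateCol Unit (((1 - s ^ 2) / ‖w‖ ^ 2 / s ^ 2) • w.ofLp) *
          Matrix.replicateRow Unit w.ofLp) := by
    ext i j
    simp only [Matrix.of_apply, lorentzInner_wrapDeriv, ← hs, EuclideanSpace.inner_single_right,
      Matrix.smul_apply, Matrix.add_apply, Matrix.mul_apply, Matrix.one_apply,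
      Matrix.replicateCol_apply, Matrix.replicateRow_apply]
    simp [eq_comm]
    field_simp
    split_ifs <;> simp
  have hww : w.ofLp ⬝ᵥ w.ofLp = ‖w‖ ^ 2 := by
    rw [EuclideanSpace.real_norm_sq_eq]
    simp [dotProduct, pow_two]
  rw [hM, Matrix.det_smul, Matrix.det_one_add_replicateCol_mul_replicateRow, dotProduct_smul, hww,
    Fintype.card_fin, smul_eq_mul]
  -- At `w = 0` the rank one term vanishes and `s = 1`; otherwise `n` is positive.
  rcases eq_or_ne w 0 with rfl | hw
  · simp [hs, sinhRatio]
  · have hr := norm_ne_zero_iff.2 hw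
    obtain ⟨m, rfl⟩ : ∃ m, n = m + 1 := by
      refine Nat.exists_eq_succ_of_ne_zero ?_
      rintro rfl
      exact hw (Subsingleton.elim _ _)
    simp only [Nat.add_sub_cancel]
    field_simp
    ring

/-! ### The wrapping map in graph coordinates -/

/-- The space-like coordinates of a vector; on the hyperboloid they invert `graphPoint`. -/
noncomputable def spatial (n : ℕ) : (Fin (n + 1) → ℝ) →L[ℝ] EuclideanSpace ℝ (Fin n) :=
  ((EuclideanSpace.equiv (Fin n) ℝ).symm : (Fin n → ℝ) →L[ℝ] EuclideanSpace ℝ (Fin n)).comp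
    (ContinuousLinearMap.pi fun i : Fin n => ContinuousLinearMap.proj i.succ)

theorem spatial_apply (x : Fin (n + 1) → ℝ) : spatial n x = WithLp.toLp 2 (Fin.tail x) := rfl

theorem graphPoint_spatial (hK : K < 0) (z : hyperboloid n K) :
    graphPoint hK (spatial n z.1) = z := by
  apply Subtype.ext
  have h := sum_sq_eq hK z
  rw [radius_sq hK] at h
  have h0 : √(‖spatial n z.1‖ ^ 2 - 1 / K) = z.1 0 := by
    rw [EuclideanSpace.real_norm_sq_eq]
    simp only [spatial_apply, Fin.tail, h]
    rw [show z.1 0 ^ 2 - -(1 / K) - 1 / K = z.1 0 ^ 2 by ring, Real.sqrt_sq z.2.2.le]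
  simp only [graphPoint, graphParam, h0]
  exact Fin.cons_self_tail z.1

theorem spatial_graphPoint (hK : K < 0) (y : EuclideanSpace ℝ (Fin n)) :
    spatial n (graphPoint hK y).1 = y := by
  simp [graphPoint, graphParam, spatial_apply]

theorem norm_sq_sub_pos (hK : K < 0) (y : EuclideanSpace ℝ (Fin n)) :
    0 < ‖y‖ ^ 2 - 1 / K := by
  have : 1 / K < 0 := one_div_neg.2 hK
  nlinarith [sq_nonneg ‖y‖]

theorem differentiable_graphParam (hK : K < 0) :
    Differentiable ℝ (graphParam K : EuclideanSpace ℝ (Fin n) → _) := by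
  intro y
  refine differentiableAt_pi.2 fun i => ?_
  refine Fin.cases ?_ (fun j => ?_) i
  · simp only [graphParam, Fin.cons_zero]
    exact ((differentiableAt_id.norm_sq ℝ).sub_const _).sqrt (norm_sq_sub_pos hK y).ne'
  · simp only [graphParam, Fin.cons_succ]
    exact (EuclideanSpace.proj j : EuclideanSpace ℝ (Fin n) →L[ℝ] ℝ).differentiableAt

/-- The wrapping map in the coordinates given by `graphPoint`, a self-map of `ℝⁿ`. -/
noncomputable def wrapCoords (hK : K < 0) (μ : hyperboloid n K) (w : EuclideanSpace ℝ (Fin n)) :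
    EuclideanSpace ℝ (Fin n) :=
  spatial n (wrap hK μ w).1

theorem graphPoint_wrapCoords (hK : K < 0) (μ : hyperboloid n K)
    (w : EuclideanSpace ℝ (Fin n)) : graphPoint hK (wrapCoords hK μ w) = wrap hK μ w :=
  graphPoint_spatial hK _

theorem hasFDerivAt_wrapCoords (hK : K < 0) (μ : hyperboloid n K)
    (w : EuclideanSpace ℝ (Fin n)) :
    HasFDerivAt (wrapCoords hK μ) ((spatial n).comp (wrapDeriv hK μ w)) w :=
  (spatial n).hasFDerivAt.comp w (hasFDerivAt_wrap hK μ w)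

theorem bijective_wrapCoords (hK : K < 0) (μ : hyperboloid n K) :
    Function.Bijective (wrapCoords hK μ) := by
  refine Function.bijective_iff_has_inverse.2 ⟨fun y => unwrap hK μ (graphPoint hK y),
    fun w => ?_, fun y => ?_⟩
  · simp only [graphPoint_wrapCoords, unwrap_wrap]
  · rw [wrapCoords, wrap_unwrap, spatial_graphPoint]

/-- The Lorentz inner product as a bilinear form. -/
noncomputable def lorentzForm (n : ℕ) : LinearMap.BilinForm ℝ (Fin (n + 1) → ℝ) :=
  LinearMap.mk₂ ℝ lorentzInner lorentzInner_add_left lorentzInner_smul_left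
    lorentzInner_add_right lorentzInner_smul_right

theorem metricMatrix_eq (y : EuclideanSpace ℝ (Fin n)) :
    metricMatrix K y = LinearMap.BilinForm.toMatrix (EuclideanSpace.basisFun (Fin n) ℝ).toBasis
      ((lorentzForm n).comp (fderiv ℝ (graphParam K) y : _ →ₗ[ℝ] _)
        (fderiv ℝ (graphParam K) y : _ →ₗ[ℝ] _)) := by
  ext i j
  simp [metricMatrix, lorentzForm, LinearMap.BilinForm.toMatrix_apply]

/-- The squared Jacobian of the wrapping map with respect to the Riemannian volume: the chain rule
for `graphParam K ∘ wrapCoords hK μ` relates the metric matrix to the Gram matrix of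
`wrapDeriv`. -/
theorem det_sq_mul_det_metricMatrix (hK : K < 0) (μ : hyperboloid n K)
    (w : EuclideanSpace ℝ (Fin n)) :
    ((spatial n).comp (wrapDeriv hK μ w)).det ^ 2 * (metricMatrix K (wrapCoords hK μ w)).det =
      (sinhRatio (radius K) ‖w‖ ^ (n - 1)) ^ 2 := by
  set Φ' := (spatial n).comp (wrapDeriv hK μ w) with hΦ'
  set G := fderiv ℝ (graphParam K) (wrapCoords hK μ w) with hG
  have hfac : wrapDeriv hK μ w = G.comp Φ' := by
    refine (hasFDerivAt_wrap hK μ w).unique ?_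
    have h := ((differentiable_graphParam hK) (wrapCoords hK μ w)).hasFDerivAt.comp w
      (hasFDerivAt_wrapCoords hK μ w)
    refine h.congr_of_eventuallyEq (Filter.Eventually.of_forall fun v => ?_)
    exact (congrArg Subtype.val (graphPoint_wrapCoords hK μ v)).symm
  set b := (EuclideanSpace.basisFun (Fin n) ℝ).toBasis
  set B := (lorentzForm n).comp (G : EuclideanSpace ℝ (Fin n) →ₗ[ℝ] _)
    (G : EuclideanSpace ℝ (Fin n) →ₗ[ℝ] _) with hB
  have hgram : (Matrix.of fun i j => lorentzInner (wrapDeriv hK μ w (EuclideanSpace.single i 1))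
      (wrapDeriv hK μ w (EuclideanSpace.single j 1))) =
      LinearMap.BilinForm.toMatrix b (B.comp (Φ' : _ →ₗ[ℝ] _) (Φ' : _ →ₗ[ℝ] _)) := by
    ext i j
    rw [hfac]
    simp [lorentzForm, LinearMap.BilinForm.toMatrix_apply, b, hB]
  rw [← det_gram_wrapDeriv hK μ w, hgram, LinearMap.BilinForm.toMatrix_comp b b, Matrix.det_mul,
    Matrix.det_mul, Matrix.det_transpose, metricMatrix_eq, LinearMap.det_toMatrix]
  change Φ'.det ^ 2 * _ = Φ'.det * _ * Φ'.det
  ring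

/-! ### Continuity of the inverse -/

theorem continuous_lorentzInner {X : Type*} [TopologicalSpace X] {f g : X → Fin (n + 1) → ℝ}
    (hf : Continuous f) (hg : Continuous g) : Continuous fun x => lorentzInner (f x) (g x) := by
  unfold lorentzInner
  fun_prop

/-- The only delicate point is `z = μ`, where the coefficient in `logMap` has a junk value but stays
bounded nearby, and the vector it multiplies tends to `0`. -/
theorem continuous_logMap (hK : K < 0) (μ : hyperboloid n K) :
    Continuous fun z => (logMap hK μ z).1 := by
  have hα : Continuous fun z : hyperboloid n K => K * lorentzInner μ.1 z.1 :=
    (continuous_lorentzInner continuous_const continuous_subtype_val).const_mul K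
  have hX : Continuous fun z : hyperboloid n K =>
      z.1 + (-(K * lorentzInner μ.1 z.1)) • μ.1 :=
    continuous_subtype_val.add (hα.neg.smul continuous_const)
  refine continuous_iff_continuousAt.2 fun z => ?_
  rcases (one_le_mul_lorentzInner hK μ z).eq_or_lt with h | h
  · have hXz : z.1 + (-(K * lorentzInner μ.1 z.1)) • μ.1 = 0 :=
      eq_zero_of_lorentzInner_self_eq_zero hK μ (v := ⟨_, sub_smul_mem_tangentSpace hK μ z⟩)
        (by rw [lorentzInner_sub_smul_self hK μ z, ← h]; ring)
    have hlog : (logMap hK μ z).1 = 0 := by simp only [logMap, hXz, smul_zero]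
    have hX0 := (hX.tendsto z).norm
    rw [hXz, norm_zero] at hX0
    rw [ContinuousAt, hlog]
    refine squeeze_zero_norm (fun y => ?_) hX0
    have h1 := one_le_mul_lorentzInner hK μ y
    have h2 := Real.arcosh_nonneg h1
    -- `arcosh α / √(α² - 1) = t / sinh t ≤ 1` for `α = cosh t`.
    simp only [logMap, norm_smul]
    refine mul_le_of_le_one_left (norm_nonneg _) ?_
    rw [← Real.sinh_arcosh h1, Real.norm_of_nonneg (div_nonneg h2 (Real.sinh_nonneg_iff.2 h2))]
    exact div_le_one_of_le₀ (Real.self_le_sinh_iff.2 h2) (Real.sinh_nonneg_iff.2 h2)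
  · have h1 : 0 < (K * lorentzInner μ.1 z.1) ^ 2 - 1 := by nlinarith
    have h2 : ContinuousAt Real.arcosh (K * lorentzInner μ.1 z.1) :=
      Real.continuousOn_arcosh.continuousAt (Ici_mem_nhds h)
    have h3 : ContinuousAt (fun z : hyperboloid n K =>
        Real.arcosh (K * lorentzInner μ.1 z.1)) z :=
      ContinuousAt.comp (f := fun z : hyperboloid n K => K * lorentzInner μ.1 z.1) h2
        hα.continuousAt
    have h4 : ContinuousAt (fun z : hyperboloid n K =>
        √((K * lorentzInner μ.1 z.1) ^ 2 - 1)) z := by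
      exact ((hα.pow 2).sub continuous_const).sqrt.continuousAt
    exact (h3.div h4 (Real.sqrt_pos.2 h1).ne').smul hX.continuousAt

theorem continuous_unwrap (hK : K < 0) (μ : hyperboloid n K) :
    Continuous (unwrap hK μ) := by
  have hl := continuous_logMap hK μ
  have h : Continuous fun z => (parallelTransport hK μ (origin n hK) (logMap hK μ z)).1 :=
    hl.add (((continuous_lorentzInner continuous_const hl).div_const _).smul continuous_const)
  exact (spatial n).continuous.comp h

/-! ### The density -/

theorem measurable_det_metricMatrix :
    Measurable fun y : EuclideanSpace ℝ (Fin n) => (metricMatrix K y).det := by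
  have h : ∀ i j, Measurable fun y : EuclideanSpace ℝ (Fin n) => metricMatrix K y i j := by
    intro i j
    have hi := fun i : Fin n => measurable_fderiv_apply_const ℝ (graphParam (n := n) K)
      (EuclideanSpace.single i 1)
    have h2 : Continuous fun p : (Fin (n + 1) → ℝ) × (Fin (n + 1) → ℝ) =>
      lorentzInner p.1 p.2 := continuous_lorentzInner continuous_fst continuous_snd
    exact h2.measurable.comp ((hi i).prodMk (hi j))
  simp only [Matrix.det_apply]
  fun_prop

/-- Every point is in the range of the wrapping map, whose Gram determinant is positive. -/
theorem det_metricMatrix_pos (hK : K < 0) (y : EuclideanSpace ℝ (Fin n)) :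
    0 < (metricMatrix K y).det := by
  obtain ⟨w, rfl⟩ := (bijective_wrapCoords hK (origin n hK)).2 y
  have h := det_sq_mul_det_metricMatrix hK (origin n hK) w
  have hs := sinhRatio_pos (radius_pos hK) (norm_nonneg w)
  have h1 : 0 < (sinhRatio (radius K) ‖w‖ ^ (n - 1)) ^ 2 := by positivity
  rw [← h] at h1
  exact pos_of_mul_pos_right h1 (sq_nonneg _)

theorem abs_det_mul_sqrt_det_metricMatrix (hK : K < 0) (μ : hyperboloid n K)
    (w : EuclideanSpace ℝ (Fin n)) :
    |((spatial n).comp (wrapDeriv hK μ w)).det| * √(metricMatrix K (wrapCoords hK μ w)).det =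
      sinhRatio (radius K) ‖w‖ ^ (n - 1) := by
  have hs := sinhRatio_pos (radius_pos hK) (norm_nonneg w)
  rw [← Real.sqrt_sq_eq_abs, ← Real.sqrt_mul (sq_nonneg _), det_sq_mul_det_metricMatrix,
    Real.sqrt_sq (by positivity)]

theorem continuous_graphPoint (hK : K < 0) :
    Continuous (graphPoint hK : EuclideanSpace ℝ (Fin n) → _) :=
  (differentiable_graphParam hK).continuous.subtype_mk _

theorem normalPDF_pos {S : Matrix (Fin n) (Fin n) ℝ} (hS : S.PosDef)
    (w : EuclideanSpace ℝ (Fin n)) : 0 < normalPDF S w := by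
  have := hS.det_pos
  unfold normalPDF
  positivity

theorem continuous_normalPDF (S : Matrix (Fin n) (Fin n) ℝ) : Continuous (normalPDF S) := by
  unfold normalPDF
  fun_prop

/-- The density of the wrapped normal distribution: the Gaussian density divided by the Jacobian of
the wrapping map. For `n = 0` the truncated exponent `n - 1` makes no difference, as
`sinhRatio (radius K) 0 = 1`. -/
noncomputable def wrappedPDF (hK : K < 0) (μ : hyperboloid n K) (S : Matrix (Fin n) (Fin n) ℝ)
    (z : hyperboloid n K) : ℝ :=
  normalPDF S (unwrap hK μ z) / sinhRatio (radius K) ‖unwrap hK μ z‖ ^ (n - 1)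

theorem wrappedPDF_pos (hK : K < 0) (μ : hyperboloid n K) {S : Matrix (Fin n) (Fin n) ℝ}
    (hS : S.PosDef) (z : hyperboloid n K) : 0 < wrappedPDF hK μ S z :=
  div_pos (normalPDF_pos hS _) (pow_pos (sinhRatio_pos (radius_pos hK) (norm_nonneg _)) _)

theorem continuous_wrappedPDF (hK : K < 0) (μ : hyperboloid n K)
    (S : Matrix (Fin n) (Fin n) ℝ) : Continuous (wrappedPDF hK μ S) := by
  have h := continuous_unwrap hK μ
  refine ((continuous_normalPDF S).comp h).div
    (((continuous_sinhRatio (radius_pos hK).ne').comp h.norm).pow _) fun z => ?_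
  exact (pow_pos (sinhRatio_pos (radius_pos hK) (norm_nonneg _)) _).ne'

theorem measurable_riemannianDensity :
    Measurable fun y : EuclideanSpace ℝ (Fin n) => ENNReal.ofReal √(metricMatrix K y).det :=
  (measurable_det_metricMatrix.sqrt).ennreal_ofReal

theorem wrappedNormal_eq_withDensity (hK : K < 0) (μ : hyperboloid n K)
    {S : Matrix (Fin n) (Fin n) ℝ} (hS : S.PosDef) :
    wrappedNormal hK μ S =
      (riemannianVolume n hK).withDensity fun z => ENNReal.ofReal (wrappedPDF hK μ S z) := by
  have hgm : Measurable (graphPoint hK : EuclideanSpace ℝ (Fin n) → _) :=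
    (continuous_graphPoint hK).measurable
  have hpm : Measurable fun z => ENNReal.ofReal (wrappedPDF hK μ S z) :=
    (continuous_wrappedPDF hK μ S).measurable.ennreal_ofReal
  have hcm : Measurable (wrapCoords hK μ) :=
    (continuous_iff_continuousAt.2 fun w =>
      (hasFDerivAt_wrapCoords hK μ w).continuousAt).measurable
  have key := map_withDensity_of_bijective volume (hasFDerivAt_wrapCoords hK μ)
    (bijective_wrapCoords hK μ) (fun y => ENNReal.ofReal √(metricMatrix K y).det *
      ENNReal.ofReal (wrappedPDF hK μ S (graphPoint hK y)))
  have hdens : ∀ w, ENNReal.ofReal |((spatial n).comp (wrapDeriv hK μ w)).det| *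
      (ENNReal.ofReal √(metricMatrix K (wrapCoords hK μ w)).det *
        ENNReal.ofReal (wrappedPDF hK μ S (graphPoint hK (wrapCoords hK μ w)))) =
      ENNReal.ofReal (normalPDF S w) := by
    intro w
    have hs := pow_pos (sinhRatio_pos (radius_pos hK) (norm_nonneg w)) (n - 1)
    rw [← mul_assoc, ← ENNReal.ofReal_mul (abs_nonneg _), abs_det_mul_sqrt_det_metricMatrix,
      ← ENNReal.ofReal_mul hs.le, graphPoint_wrapCoords, wrappedPDF, unwrap_wrap,
      mul_div_cancel₀ _ hs.ne']
  simp only [hdens] at key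
  have hwrap : (fun w => expMap hK μ (parallelTransport hK (origin n hK) μ
      (toTangentOrigin hK w))) = graphPoint hK ∘ wrapCoords hK μ :=
    funext fun w => (graphPoint_wrapCoords hK μ w).symm
  rw [wrappedNormal, multivariateGaussian_eq_withDensity hS, hwrap, ← Measure.map_map hgm hcm,
    key, riemannianVolume]
  ext A hA
  rw [Measure.map_apply hgm hA, withDensity_apply _ (hgm hA), withDensity_apply _ hA,
    setLIntegral_map hA hpm hgm,
    setLIntegral_withDensity_eq_setLIntegral_mul volume measurable_riemannianDensity
      (g := fun y => ENNReal.ofReal (wrappedPDF hK μ S (graphPoint hK y)))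
      (hpm.comp hgm) (hgm hA)]
  rfl

/-- Continuous densities are unique since the Riemannian volume has a positive density with respect
to Lebesgue measure in the graph coordinates. -/
theorem IsContinuousDensity.unique {hK : K < 0} {P : Measure (hyperboloid n K)}
    [IsFiniteMeasure P] {p q : hyperboloid n K → ℝ}
    (hp : IsContinuousDensity (riemannianVolume n hK) P p)
    (hq : IsContinuousDensity (riemannianVolume n hK) P q) : q = p := by
  obtain ⟨hpc, hp0, hpP⟩ := hp
  obtain ⟨hqc, hq0, hqP⟩ := hq
  have hgc := continuous_graphPoint (n := n) hK
  have hfin : ∫⁻ z, ENNReal.ofReal (q z) ∂(riemannianVolume n hK) ≠ ∞ := by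
    rw [← setLIntegral_univ, ← withDensity_apply _ MeasurableSet.univ, ← hqP]
    exact measure_ne_top P _
  have hae := (withDensity_eq_iff hqc.measurable.ennreal_ofReal.aemeasurable
    hpc.measurable.ennreal_ofReal.aemeasurable hfin).1 (hqP.symm.trans hpP)
  have h1 := ae_of_ae_map hgc.measurable.aemeasurable hae
  rw [ae_withDensity_iff measurable_riemannianDensity] at h1
  have h2 : q ∘ graphPoint hK =ᵐ[volume] p ∘ graphPoint hK := by
    filter_upwards [h1] with y hy
    have hpos : ENNReal.ofReal √(metricMatrix K y).det ≠ 0 :=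
      (ENNReal.ofReal_pos.2 (Real.sqrt_pos.2 (det_metricMatrix_pos hK y))).ne'
    exact (ENNReal.ofReal_eq_ofReal_iff (hq0 _) (hp0 _)).1 (hy hpos)
  have h3 := ((hqc.comp hgc).ae_eq_iff_eq volume (hpc.comp hgc)).1 h2
  funext z
  rw [← graphPoint_spatial hK z]
  exact congrFun h3 _

theorem log_wrappedPDF (hK : K < 0) (μ : hyperboloid n K) {S : Matrix (Fin n) (Fin n) ℝ}
    (hS : S.PosDef) (z : hyperboloid n K) :
    Real.log (wrappedPDF hK μ S z) = Real.log (normalPDF S (unwrap hK μ z)) -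
      ((n : ℝ) - 1) * Real.log (sinhRatio (radius K) ‖unwrap hK μ z‖) := by
  have hs := sinhRatio_pos (radius_pos hK) (norm_nonneg (unwrap hK μ z))
  rw [wrappedPDF, Real.log_div (normalPDF_pos hS _).ne' (pow_pos hs _).ne', Real.log_pow]
  rcases n.eq_zero_or_pos with rfl | hn
  · have h0 : unwrap hK μ z = 0 := Subsingleton.elim _ _
    simp [h0, sinhRatio]
  · rw [Nat.cast_pred hn]

end HypWN

theorem mainTheorem9 (n : ℕ) (K : ℝ) (hK : K < 0) (μ : HypWN.hyperboloid n K)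
    (S : Matrix (Fin n) (Fin n) ℝ) (hS : S.PosDef) :
    ∃ p : HypWN.hyperboloid n K → ℝ,
      HypWN.IsContinuousDensity (HypWN.riemannianVolume n hK) (HypWN.wrappedNormal hK μ S) p ∧
      (∀ q : HypWN.hyperboloid n K → ℝ,
        HypWN.IsContinuousDensity (HypWN.riemannianVolume n hK)
          (HypWN.wrappedNormal hK μ S) q → q = p) ∧
      ∀ z : HypWN.hyperboloid n K,
        let u : HypWN.tangentSpace μ := HypWN.logMap hK μ z
        let v : HypWN.tangentSpace (HypWN.origin n hK) :=
          HypWN.parallelTransport hK μ (HypWN.origin n hK) u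
        0 < p z ∧
        Real.log (p z) = Real.log (HypWN.normalPDF S (HypWN.originCoords hK v)) -
          ((n : ℝ) - 1) *
            Real.log (HypWN.sinhRatio (HypWN.radius K) (HypWN.lorentzNorm u.1)) := by
  have hdens : HypWN.IsContinuousDensity (HypWN.riemannianVolume n hK)
      (HypWN.wrappedNormal hK μ S) (HypWN.wrappedPDF hK μ S) :=
    ⟨HypWN.continuous_wrappedPDF hK μ S, fun z => (HypWN.wrappedPDF_pos hK μ hS z).le,
      HypWN.wrappedNormal_eq_withDensity hK μ hS⟩
  have hfin : IsFiniteMeasure (HypWN.wrappedNormal hK μ S) := by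
    unfold HypWN.wrappedNormal
    infer_instance
  refine ⟨HypWN.wrappedPDF hK μ S, hdens, fun q hq => hdens.unique hq, fun z => ?_⟩
  refine ⟨HypWN.wrappedPDF_pos hK μ hS z, ?_⟩
  rw [HypWN.log_wrappedPDF hK μ hS, HypWN.norm_unwrap]
  rfl
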